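/- Let $0<q<1$ and $a>0$. Write $(x;q)_k=\prod_{i=0}^{k-1}(1-xq^i)$ and $(x;q)_\infty=\prod_{i\ge 0}(1-xq^i)$. For $m,n=0,1,2,\dots$ put $\mu(m)=q^{-m}-aq^m$, $$d_n(\mu(m);a;q)={}_3\phi_0\left(q^{-m},-aq^m,q^{-n};-;q,-q^n/a\right)=\sum_{k\ge 0}\frac{(q^{-m};q)_k(-aq^m;q)_k(q^{-n};q)_k}{(q;q)_k}\left((-1)^kq^{k(k-1)/2}\right)^{-2}\left(-\frac{q^n}{a}\right)^k$$ (a finite sum) and $$w(m)=\frac{(1+aq^{2m})a^m}{(-aq^m;q)_\infty(q;q)_m}\,q^{m(3m-1)/2}.$$ (i) Let $\mathfrak l^2$ be the Hilbert space of functions $f:\{0,1,2,\dots\}\to\mathbb C$ with $\sum_m w(m)|f(m)|^2<\infty$ and scalar product $\langle f_1,f_2\rangle=\sum_{m=0}^\infty w(m)f_1(m)\overline{f_2(m)}$. The functions $m\mapsto d_n(\mu(m);a;q)$, $n=0,1,2,\dots$, belong to $\mathfrak l^2$ and form a complete orthogonal basis of it (they are nonzero and pairwise orthogonal, and their linear span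 is dense), with $$\sum_{m=0}^\infty w(m)\,d_n(\mu(m);a;q)\,d_{n'}(\mu(m);a;q)=\frac{(q;q)_n}{a^nq^{n(n+1)/2}}\,\delta_{nn'}.$$ (ii) For each $n$ there is a real polynomial of degree exactly $n$, the dual alternative $q$-Charlier polynomial, whose value at $\mu(m)$ is $d_n(\mu(m);a;q)$ for all $m\ge 0$. The point measure $\sigma=\sum_{m\ge 0}w(m)\,\delta_{\mu(m)}$ on $\mathbb R$ is an orthogonality measure for these polynomials, and it is extremal (N-extremal): all its moments are finite and the polynomials are dense in the complex Hilbert space $L^2(\mathbb R,\sigma)$. -/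

import Mathlib

open MeasureTheory Polynomial
open scoped ComplexConjugate ENNReal

noncomputable section

/-- The finite `q`-shifted factorial `(x;q)_k = ∏_{i<k} (1 - x q^i)`. -/
def qPoch (x q : ℝ) (k : ℕ) : ℝ := ∏ i ∈ Finset.range k, (1 - x * q ^ i)

/-- The infinite `q`-shifted factorial `(x;q)_∞ = ∏_{i≥0} (1 - x q^i)`. -/
def qPochInf (x q : ℝ) : ℝ := ∏' i : ℕ, (1 - x * q ^ i)

/-- The basic hypergeometric series `ᵣφₛ(upper; lower; q, z)`, in the normalization
`∑ₖ (upper;q)ₖ / ((lower;q)ₖ (q;q)ₖ) * ((-1)^k q^(k(k-1)/2))^(1+s-r) * z^k`. -/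
def basicHypergeometric (upper lower : List ℝ) (q z : ℝ) : ℝ :=
  ∑' k : ℕ, (upper.map fun x => qPoch x q k).prod /
      ((lower.map fun x => qPoch x q k).prod * qPoch q q k) *
    ((-1) ^ k * q ^ (k * (k - 1) / 2)) ^ (1 + (lower.length : ℤ) - (upper.length : ℤ)) * z ^ k

/-- The `q`-quadratic lattice `μ(m) = q^(-m) - a q^m`. -/
def qLattice (a q : ℝ) (m : ℕ) : ℝ := q ^ (-(m : ℤ)) - a * q ^ m

/-- The value `d_n(μ(m); a; q) = ₃φ₀(q^(-m), -a q^m, q^(-n); -; q, -q^n/a)` of the dual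
alternative `q`-Charlier polynomial of degree `n` at the lattice point `μ(m)`. -/
def dualAltQCharlier (a q : ℝ) (n m : ℕ) : ℝ :=
  basicHypergeometric [q ^ (-(m : ℤ)), -a * q ^ m, q ^ (-(n : ℤ))] [] q (-q ^ n / a)

/-- The weight `(1 + a q^(2m)) a^m / ((-a q^m;q)_∞ (q;q)_m) * q^(m(3m-1)/2)`.
The natural number `m (3m - 1)` is even, and it is `0` for `m = 0`. -/
def dualWeight (a q : ℝ) (m : ℕ) : ℝ :=
  (1 + a * q ^ (2 * m)) * a ^ m / (qPochInf (-a * q ^ m) q * qPoch q q m) *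
    q ^ (m * (3 * m - 1) / 2)

/-- The measure on `ℕ` with mass `dualWeight a q m` at `m`. -/
def dualIndexMeasure (a q : ℝ) : Measure ℕ :=
  Measure.sum fun m : ℕ => ENNReal.ofReal (dualWeight a q m) • Measure.dirac m

/-- The point measure on the real line with mass `dualWeight a q m` at the point `μ(m)`. -/
def dualPointMeasure (a q : ℝ) : Measure ℝ :=
  Measure.sum fun m : ℕ => ENNReal.ofReal (dualWeight a q m) • Measure.dirac (qLattice a q m)

/-- The weighted `ℓ²`-space of complex functions on `{0, 1, 2, …}`. -/
abbrev DualL2 (a q : ℝ) : Type := Lp ℂ 2 (dualIndexMeasure a q)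

/-- An orthogonal basis of a Hilbert space: nonzero, pairwise orthogonal vectors whose
linear span is dense. -/
structure IsOrthogonalBasis {H : Type*} [NormedAddCommGroup H] [InnerProductSpace ℂ H]
    (v : ℕ → H) : Prop where
  ne_zero : ∀ n, v n ≠ 0
  orthogonal : ∀ n k, n ≠ k → inner ℂ (v n) (v k) = 0
  complete : (Submodule.span ℂ (Set.range v)).topologicalClosure = ⊤

/-- `P` is a sequence of orthogonal polynomials (`deg P n = n`) for the measure `μ`, all of
whose moments are finite. -/
structure IsOrthogonalityMeasure (μ : Measure ℝ) (P : ℕ → ℝ[X]) : Prop where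
  degree_eq : ∀ n, (P n).degree = n
  moments : ∀ k : ℕ, Integrable (fun x : ℝ => x ^ k) μ
  orthogonal : ∀ n k, n ≠ k → ∫ x, (P n).eval x * (P k).eval x ∂μ = 0
  norm_pos : ∀ n, 0 < ∫ x, (P n).eval x ^ 2 ∂μ

/-- `μ` is an extremal (N-extremal) solution of its moment problem: all moments are finite and
the polynomials are dense in `L²(μ)`. -/
structure IsExtremalMeasure (μ : Measure ℝ) : Prop where
  moments : ∀ k : ℕ, Integrable (fun x : ℝ => x ^ k) μ
  dense : Dense {f : Lp ℂ 2 μ | ∃ p : ℂ[X], f =ᵐ[μ] fun x : ℝ => p.eval (x : ℂ)}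

theorem qPoch_self_pos {q : ℝ} (hq0 : 0 < q) (hq1 : q < 1) (k : ℕ) : 0 < qPoch q q k := by
  unfold qPoch
  refine Finset.prod_pos fun i _ => ?_
  have h1 : q * q ^ i = q ^ (i + 1) := by ring
  have h2 : q ^ (i + 1) < 1 := pow_lt_one₀ hq0.le hq1 (Nat.succ_ne_zero i)
  linarith

theorem qPochInf_nonneg {a q : ℝ} (hq0 : 0 < q) (ha : 0 < a) (m : ℕ) :
    0 ≤ qPochInf (-a * q ^ m) q := by
  unfold qPochInf
  by_cases h : Multipliable fun i : ℕ => 1 - -a * q ^ m * q ^ i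
  · refine ge_of_tendsto' h.hasProd fun s => Finset.prod_nonneg fun i _ => ?_
    have : 0 ≤ a * q ^ m * q ^ i := by positivity
    linarith
  · rw [tprod_eq_one_of_not_multipliable h]
    exact zero_le_one

theorem dualWeight_nonneg {a q : ℝ} (hq0 : 0 < q) (hq1 : q < 1) (ha : 0 < a) (m : ℕ) :
    0 ≤ dualWeight a q m := by
  have h1 := (qPoch_self_pos hq0 hq1 m).le
  have h2 := qPochInf_nonneg (a := a) hq0 ha m
  unfold dualWeight
  positivity

/-- The scalar product of `DualL2` is `⟨f, g⟩ = ∑ₘ w(m) f(m) conj (g(m))`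
(Mathlib's `inner` is conjugate-linear in its first argument). -/
theorem hasSum_dualL2_inner {a q : ℝ} (hq0 : 0 < q) (hq1 : q < 1) (ha : 0 < a)
    (f g : DualL2 a q) :
    HasSum (fun m : ℕ => (dualWeight a q m : ℂ) * f m * conj (g m)) (inner ℂ g f) := by
  have hi := L2.integrable_inner (𝕜 := ℂ) g f
  have h := hasSum_integral_measure (μ := fun m : ℕ =>
    ENNReal.ofReal (dualWeight a q m) • Measure.dirac m) (f := fun m => inner ℂ (g m) (f m)) hi
  rw [L2.inner_def]
  have e : (fun m : ℕ => (dualWeight a q m : ℂ) * f m * conj (g m)) = fun m : ℕ =>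
      ∫ x, inner ℂ (g x) (f x) ∂(ENNReal.ofReal (dualWeight a q m) • Measure.dirac m) := by
    funext m
    rw [integral_smul_measure, integral_dirac,
      ENNReal.toReal_ofReal (dualWeight_nonneg hq0 hq1 ha m)]
    simp [mul_assoc]
  rw [e]
  exact h

end

open Filter Topology

/-! ### Finite q-shifted factorials and the q-Chu–Vandermonde sum. -/

section Algebra

/-! The proof is a duality argument. For fixed `m`, the value `d_n(μ(m))` is a polynomial of degree
`m` in `q^n` (`rowPoly`), an alternative q-Charlier polynomial. These are orthogonal for the masses
`p(n) = charlierWeight a q n` at the points `q^n`, with squared norms `1/w(m)`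
(`hasSum_dualAltQCharlier_row`): Euler's summation gives the moments of the products `∏_{i<k} (x -
q^i)`, and q-Chu–Vandermonde sums them to a product that vanishes on powers below `m`.

The row polynomials are also complete: a summable sequence annihilated by all powers `(q^n)^l` is
zero, since letting `l → ∞` isolates its first nonzero term.

Hence the rows of the real matrix `√w(m) √p(n) d_n(μ(m))` form an orthonormal basis of `ℓ²`. The
matrix is unitary, so its columns are orthonormal and complete as well. Orthonormality of the
columns is the dual orthogonality relation, with squared norms `1/p(n)`; completeness is density of
the span. Since `(q^(-m);q)_k (-a q^m;q)_k` is a polynomial of degree `k` in `μ(m)`, the columns are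
polynomials on the lattice, and the same completeness yields extremality. -/

theorem qPoch_zero (x q : ℝ) : qPoch x q 0 = 1 := by simp [qPoch]

theorem qPoch_succ (x q : ℝ) (k : ℕ) : qPoch x q (k + 1) = qPoch x q k * (1 - x * q ^ k) := by
  simp [qPoch, Finset.prod_range_succ]

theorem qPoch_succ' (x q : ℝ) (k : ℕ) : qPoch x q (k + 1) = (1 - x) * qPoch (x * q) q k := by
  simp only [qPoch, Finset.prod_range_succ', pow_zero, mul_one]
  rw [mul_comm]
  congr 1
  exact Finset.prod_congr rfl fun i _ => by ring

theorem qPoch_add (x q : ℝ) (k l : ℕ) :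
    qPoch x q (k + l) = qPoch x q k * qPoch (x * q ^ k) q l := by
  simp only [qPoch, Finset.prod_range_add]
  congr 1
  exact Finset.prod_congr rfl fun i _ => by ring

/-- The product `∏_{i<k} (x - q^i)`. -/
def qFalling (q x : ℝ) (k : ℕ) : ℝ := ∏ i ∈ Finset.range k, (x - q ^ i)

theorem qFalling_zero (q x : ℝ) : qFalling q x 0 = 1 := by simp [qFalling]

theorem qFalling_succ (q x : ℝ) (k : ℕ) :
    qFalling q x (k + 1) = qFalling q x k * (x - q ^ k) := by
  simp [qFalling, Finset.prod_range_succ]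

/-- Each factor with `i ≥ 1` is `x q - q^i = q (x - q^(i-1))`. -/
theorem qFalling_succ_mul (q x : ℝ) (k : ℕ) :
    qFalling q (x * q) (k + 1) = (x * q - 1) * q ^ k * qFalling q x k := by
  induction k with
  | zero => simp [qFalling]
  | succ k ih => rw [qFalling_succ, ih, qFalling_succ]; ring

theorem qFalling_eq_zero (q : ℝ) {m k : ℕ} (h : m < k) : qFalling q (q ^ m) k = 0 :=
  Finset.prod_eq_zero (Finset.mem_range.2 h) (sub_self _)

theorem qPoch_zpow_neg {q : ℝ} (hq : q ≠ 0) (m k : ℕ) :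
    qPoch (q ^ (-(m : ℤ))) q k * (q ^ m) ^ k = qFalling q (q ^ m) k := by
  unfold qPoch qFalling
  rw [Finset.pow_eq_prod_const, ← Finset.prod_mul_distrib]
  refine Finset.prod_congr rfl fun i _ => ?_
  rw [zpow_neg, zpow_natCast]
  field_simp

/-- The quotient `∏_{i<k} (x - q^i) / (q;q)_k`, a signed `q`-binomial coefficient at `x = q^m`. -/
noncomputable def qFallingQuot (q x : ℝ) (k : ℕ) : ℝ := qFalling q x k / qPoch q q k

theorem qFallingQuot_pascal {q : ℝ} (hq0 : 0 < q) (hq1 : q < 1) (x : ℝ) (k : ℕ) :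
    qFallingQuot q (x * q) (k + 1) = qFallingQuot q x (k + 1) - x * qFallingQuot q x k := by
  have h1 := (qPoch_self_pos hq0 hq1 k).ne'
  have h2 := (qPoch_self_pos hq0 hq1 (k + 1)).ne'
  unfold qFallingQuot
  rw [qFalling_succ_mul, qFalling_succ]
  rw [qPoch_succ] at h2 ⊢
  have h3 := right_ne_zero_of_mul h2
  field_simp
  ring

/-- The `q`-Chu–Vandermonde summation. -/
theorem qVandermonde {q : ℝ} (hq0 : 0 < q) (hq1 : q < 1) (m : ℕ) (b u : ℝ) :
    ∑ j ∈ Finset.range (m + 1), qFallingQuot q (q ^ m) j *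
      (qPoch b q j * u ^ j * qPoch (b * u * q ^ j) q (m - j)) = qPoch u q m := by
  induction m generalizing b with
  | zero => simp [qFallingQuot, qFalling_zero, qPoch_zero]
  | succ m ih =>
    set g : ℕ → ℝ := fun j => qPoch b q j * u ^ j * qPoch (b * u * q ^ j) q (m + 1 - j) with hg
    -- Pascal's rule splits the sum in two. The first part is the case `m` with the same `b`; the
    -- second, since `(b;q)_{j+1} = (1 - b)(bq;q)_j`, is the case `m` with `b q`. This is why the
    -- induction generalizes `b`.
    have key : ∑ j ∈ Finset.range (m + 1 + 1), qFallingQuot q (q ^ (m + 1)) j * g j =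
        ∑ j ∈ Finset.range (m + 1), qFallingQuot q (q ^ m) j * g j -
          q ^ m * ∑ j ∈ Finset.range (m + 1), qFallingQuot q (q ^ m) j * g (j + 1) := by
      have e : ∑ j ∈ Finset.range (m + 1), qFallingQuot q (q ^ m) j * g j =
          ∑ j ∈ Finset.range (m + 1 + 1), qFallingQuot q (q ^ m) j * g j := by
        rw [Finset.sum_range_succ _ (m + 1)]
        simp [qFallingQuot, qFalling_eq_zero q (Nat.lt_succ_self m)]
      rw [e, Finset.sum_range_succ', Finset.sum_range_succ' _ (m + 1), Finset.mul_sum,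
        add_sub_right_comm, ← Finset.sum_sub_distrib]
      congr 1
      refine Finset.sum_congr rfl fun j _ => ?_
      rw [pow_succ, qFallingQuot_pascal hq0 hq1]
      ring
    rw [key]
    have e1 : ∑ j ∈ Finset.range (m + 1), qFallingQuot q (q ^ m) j * g j =
        (1 - b * u * q ^ m) * qPoch u q m := by
      rw [← ih b, Finset.mul_sum]
      refine Finset.sum_congr rfl fun j hj => ?_
      have hj' : j ≤ m := Nat.lt_succ_iff.1 (Finset.mem_range.1 hj)
      simp only [hg]
      rw [Nat.succ_sub hj', qPoch_succ]
      have : q ^ m = q ^ j * q ^ (m - j) := by rw [← pow_add, Nat.add_sub_cancel' hj']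
      rw [this]
      ring
    have e2 : ∑ j ∈ Finset.range (m + 1), qFallingQuot q (q ^ m) j * g (j + 1) =
        u * (1 - b) * qPoch u q m := by
      rw [← ih (b * q), Finset.mul_sum]
      refine Finset.sum_congr rfl fun j hj => ?_
      simp only [hg]
      rw [Nat.succ_sub_succ, qPoch_succ', show b * q * u * q ^ j = b * u * q ^ (j + 1) by ring]
      ring
    rw [e1, e2, qPoch_succ]
    ring

end Algebra

/-! ### Euler's summation and the factorial moments of the q-Charlier weight. -/

section Euler

variable {a q : ℝ}

/-- The weight `a^n q^(n(n+1)/2) / (q;q)_n` of the alternative `q`-Charlier polynomials. -/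
noncomputable def charlierWeight (a q : ℝ) (n : ℕ) : ℝ := a ^ n * q ^ (n * (n + 1) / 2) / qPoch q q n

theorem charlierWeight_pos (hq0 : 0 < q) (hq1 : q < 1) (ha : 0 < a) (n : ℕ) :
    0 < charlierWeight a q n := by
  have := qPoch_self_pos hq0 hq1 n
  unfold charlierWeight
  positivity

theorem charlierWeight_zero (a q : ℝ) : charlierWeight a q 0 = 1 := by
  simp [charlierWeight, qPoch_zero]

theorem charlierWeight_succ (hq0 : 0 < q) (hq1 : q < 1) (n : ℕ) :
    charlierWeight a q (n + 1) * (1 - q ^ (n + 1)) = a * q ^ (n + 1) * charlierWeight a q n := by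
  have h1 := (qPoch_self_pos hq0 hq1 n).ne'
  have h2 := (qPoch_self_pos hq0 hq1 (n + 1)).ne'
  have e : (n + 1) * (n + 1 + 1) / 2 = n * (n + 1) / 2 + (n + 1) := by
    rw [show (n + 1) * (n + 1 + 1) = n * (n + 1) + (n + 1) * 2 by ring,
      Nat.add_mul_div_right _ _ two_pos]
  unfold charlierWeight
  rw [e]
  rw [qPoch_succ, ← pow_succ'] at h2 ⊢
  have h3 := right_ne_zero_of_mul h2
  field_simp
  ring

theorem summable_charlierWeight (hq0 : 0 < q) (hq1 : q < 1) (ha : 0 < a) :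
    Summable (charlierWeight a q) := by
  have hp := charlierWeight_pos hq0 hq1 ha
  refine summable_of_ratio_test_tendsto_lt_one zero_lt_one
    (Eventually.of_forall fun n => (hp n).ne') ?_
  have hq : Tendsto (fun n : ℕ => q ^ (n + 1)) atTop (𝓝 0) :=
    (tendsto_add_atTop_iff_nat 1).2 (tendsto_pow_atTop_nhds_zero_of_lt_one hq0.le hq1)
  have h : Tendsto (fun n : ℕ => a * q ^ (n + 1) / (1 - q ^ (n + 1))) atTop
      (𝓝 (a * 0 / (1 - 0))) := (hq.const_mul a).div (hq.const_sub 1) (by norm_num)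
  rw [mul_zero, zero_div] at h
  refine h.congr fun n => ?_
  rw [Real.norm_of_nonneg (hp _).le, Real.norm_of_nonneg (hp _).le]
  have h2 : q ^ (n + 1) < 1 := pow_lt_one₀ hq0.le hq1 (Nat.succ_ne_zero n)
  have h3 : 1 - q ^ (n + 1) ≠ 0 := by linarith
  rw [div_eq_div_iff h3 (hp n).ne', charlierWeight_succ hq0 hq1]

theorem summable_charlierWeight_mul_pow (hq0 : 0 < q) (hq1 : q < 1) (ha : 0 < a) (l : ℕ) :
    Summable fun n => charlierWeight a q n * (q ^ n) ^ l := by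
  have hp := charlierWeight_pos hq0 hq1 ha
  refine (summable_charlierWeight hq0 hq1 ha).of_nonneg_of_le
    (fun n => mul_nonneg (hp n).le (by positivity)) fun n => ?_
  exact mul_le_of_le_one_right (hp n).le (pow_le_one₀ (by positivity) (pow_le_one₀ hq0.le hq1.le))

/-- For a summable sequence `h`, the sums `∑ₙ q^(nl) hₙ` tend to `h₀` as `l → ∞`. -/
theorem tendsto_tsum_mul_pow {E : Type*} [NormedAddCommGroup E] [NormedSpace ℝ E]
    [CompleteSpace E] (hq0 : 0 < q) (hq1 : q < 1) {h : ℕ → E} (hs : Summable fun n => ‖h n‖) :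
    Tendsto (fun l : ℕ => ∑' n, ((q ^ n) ^ l) • h n) atTop (𝓝 (h 0)) := by
  -- The limit is taken termwise, dominated by `‖h n‖`; only `n = 0` survives.
  have e : h 0 = ∑' n, if n = 0 then h 0 else 0 := by rw [tsum_ite_eq]
  rw [e]
  refine tendsto_tsum_of_dominated_convergence hs (fun n => ?_) (Eventually.of_forall fun l n => ?_)
  · rcases eq_or_ne n 0 with rfl | hn
    · simp
    · simp only [hn, if_false]
      rw [← zero_smul ℝ (h n)]
      exact (tendsto_pow_atTop_nhds_zero_of_lt_one (by positivity)
        (pow_lt_one₀ hq0.le hq1 hn)).smul_const _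
  · rw [norm_smul, Real.norm_of_nonneg (by positivity)]
    exact mul_le_of_le_one_left (norm_nonneg _)
      (pow_le_one₀ (by positivity) (pow_le_one₀ hq0.le hq1.le))

theorem multipliable_qPochInf (hq0 : 0 < q) (hq1 : q < 1) (x : ℝ) :
    Multipliable fun i : ℕ => 1 - x * q ^ i := by
  simp_rw [sub_eq_add_neg]
  refine multipliable_one_add_of_summable ?_
  simp only [norm_neg]
  exact ((summable_geometric_of_lt_one hq0.le hq1).mul_left x).norm

theorem qPochInf_eq_mul (hq0 : 0 < q) (hq1 : q < 1) (x : ℝ) (k : ℕ) :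
    qPochInf x q = qPoch x q k * qPochInf (x * q ^ k) q := by
  have h1 := (multipliable_qPochInf hq0 hq1 x).hasProd.tendsto_prod_nat
  have h2 := ((multipliable_qPochInf hq0 hq1 (x * q ^ k)).hasProd.tendsto_prod_nat).const_mul
    (qPoch x q k)
  refine tendsto_nhds_unique ((tendsto_add_atTop_iff_nat k).2 h1) (h2.congr fun n => ?_)
  rw [add_comm n k]
  exact (qPoch_add x q k n).symm

/-- Euler's summation `∑ₙ zⁿ q^(n(n-1)/2) / (q;q)_n = (-z;q)_∞` at `z = a q^(l+1)`. -/
theorem hasSum_charlierWeight_mul_pow (hq0 : 0 < q) (hq1 : q < 1) (ha : 0 < a) (l : ℕ) :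
    HasSum (fun n => charlierWeight a q n * (q ^ n) ^ l) (qPochInf (-a * q ^ (l + 1)) q) := by
  have hs := summable_charlierWeight_mul_pow hq0 hq1 ha
  set f : ℕ → ℝ := fun l => ∑' n, charlierWeight a q n * (q ^ n) ^ l with hf
  -- The weight recursion gives a functional equation in `l`. Iterated, it produces the partial
  -- products, and `f → 1` leaves the infinite product.
  have step : ∀ l, f l = (1 - -a * q ^ (l + 1)) * f (l + 1) := by
    intro l
    have e : f l - f (l + 1) = a * q ^ (l + 1) * f (l + 1) := by
      simp only [hf]
      rw [← (hs l).tsum_sub (hs (l + 1)), ((hs l).sub (hs (l + 1))).tsum_eq_zero_add,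
        ← tsum_mul_left]
      simp only [pow_zero, one_pow, sub_self, zero_add]
      refine tsum_congr fun n => ?_
      have h := charlierWeight_succ (a := a) hq0 hq1 n
      calc _ = charlierWeight a q (n + 1) * (1 - q ^ (n + 1)) * (q ^ (n + 1)) ^ l := by ring
        _ = _ := by rw [h]; ring
    linarith
  have prod : ∀ N, f l = qPoch (-a * q ^ (l + 1)) q N * f (N + l) := by
    intro N
    induction N with
    | zero => simp [qPoch_zero]
    | succ N ih =>
      rw [ih, step, qPoch_succ, show N + 1 + l = N + l + 1 by ring]
      ring
  have lim : Tendsto f atTop (𝓝 1) := by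
    have := tendsto_tsum_mul_pow hq0 hq1 (h := charlierWeight a q)
      (summable_charlierWeight hq0 hq1 ha).norm
    rw [charlierWeight_zero] at this
    refine this.congr fun l => tsum_congr fun n => ?_
    rw [smul_eq_mul, mul_comm]
  have lim2 := (multipliable_qPochInf hq0 hq1 (-a * q ^ (l + 1))).hasProd.tendsto_prod_nat.mul
    ((tendsto_add_atTop_iff_nat l).2 lim)
  have : f l = qPochInf (-a * q ^ (l + 1)) q := by
    refine tendsto_nhds_unique (l := atTop) (tendsto_const_nhds.congr prod) ?_
    simpa [qPochInf, qPoch] using lim2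
  rw [← this]
  exact (hs l).hasSum

/-- Euler's sum has nonnegative terms and first term 1. It covers only exponents `m + 1`, so one
factor is split off. -/
theorem qPochInf_pos (hq0 : 0 < q) (hq1 : q < 1) (ha : 0 < a) (m : ℕ) :
    0 < qPochInf (-a * q ^ m) q := by
  have h : 0 < qPochInf (-a * q ^ (m + 1)) q := by
    rw [← (hasSum_charlierWeight_mul_pow hq0 hq1 ha m).tsum_eq]
    refine (summable_charlierWeight_mul_pow hq0 hq1 ha m).tsum_pos (fun n => ?_) 0 ?_
    · exact mul_nonneg (charlierWeight_pos hq0 hq1 ha n).le (by positivity)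
    · simp [charlierWeight_zero]
  rw [qPochInf_eq_mul hq0 hq1 _ 1, qPoch_succ, qPoch_zero,
    show -a * q ^ m * q ^ 1 = -a * q ^ (m + 1) by ring]
  refine mul_pos ?_ h
  have : 0 < a * q ^ m := by positivity
  simp
  linarith

/-- The new factor `x - q^k` expresses the case `(k + 1, l)` as `(k, l + 1)` minus `q^k` times `(k,
l)`; the two infinite products differ by one factor. -/
theorem hasSum_charlierWeight_mul_qFalling (hq0 : 0 < q) (hq1 : q < 1) (ha : 0 < a) (k l : ℕ) :
    HasSum (fun n => charlierWeight a q n * (qFalling q (q ^ n) k * (q ^ n) ^ l))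
      ((-a) ^ k * q ^ (k * k + k * l) * qPochInf (-a * q ^ (k + l + 1)) q) := by
  induction k generalizing l with
  | zero => simpa [qFalling_zero] using hasSum_charlierWeight_mul_pow hq0 hq1 ha l
  | succ k ih =>
    have h := (ih (l + 1)).sub ((ih l).mul_left (q ^ k))
    have e : (-a) ^ (k + 1) * q ^ ((k + 1) * (k + 1) + (k + 1) * l) *
          qPochInf (-a * q ^ (k + 1 + l + 1)) q =
        (-a) ^ k * q ^ (k * k + k * (l + 1)) * qPochInf (-a * q ^ (k + (l + 1) + 1)) q -
          q ^ k * ((-a) ^ k * q ^ (k * k + k * l) * qPochInf (-a * q ^ (k + l + 1)) q) := by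
      rw [qPochInf_eq_mul hq0 hq1 (-a * q ^ (k + l + 1)) 1, qPoch_succ, qPoch_zero,
        show -a * q ^ (k + l + 1) * q ^ 1 = -a * q ^ (k + l + 2) by ring,
        show k + 1 + l + 1 = k + l + 2 by ring, show k + (l + 1) + 1 = k + l + 2 by ring]
      ring
    rw [e]
    refine h.congr_fun fun n => ?_
    rw [qFalling_succ]
    ring

end Euler

/-! ### Alternative q-Charlier polynomials: orthogonality and completeness of the rows. -/

section RowPolynomials

variable {a q : ℝ}

/-- The coefficient of `∏_{i<k} (x - q^i)` in the expansion of `d_n(μ(m); a; q)` at `x = q^n`. -/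
noncomputable def rowCoeff (a q : ℝ) (m k : ℕ) : ℝ :=
  qPoch (q ^ (-(m : ℤ))) q k * qPoch (-a * q ^ m) q k / qPoch q q k *
    ((q ^ (k * (k - 1)))⁻¹ * (-1 / a) ^ k)

theorem pow_half_sq (q : ℝ) (k : ℕ) : (q ^ (k * (k - 1) / 2)) ^ 2 = q ^ (k * (k - 1)) := by
  rw [← pow_mul, Nat.div_mul_cancel]
  exact (Nat.even_mul_pred_self k).two_dvd

theorem qPoch_zpow_neg_eq_zero {q : ℝ} (hq : q ≠ 0) {m k : ℕ} (h : m < k) :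
    qPoch (q ^ (-(m : ℤ))) q k = 0 := by
  refine (mul_eq_zero.1 ((qPoch_zpow_neg hq m k).trans (qFalling_eq_zero q h))).resolve_right ?_
  exact pow_ne_zero _ (pow_ne_zero _ hq)

theorem rowCoeff_eq_zero (hq : q ≠ 0) {m k : ℕ} (h : m < k) : rowCoeff a q m k = 0 := by
  rw [rowCoeff, qPoch_zpow_neg_eq_zero hq h, zero_mul, zero_div, zero_mul]

/-- Three upper and no lower parameters give the exponent `-2`, which kills the sign. The factor
`q^(nk)` of the argument clears the negative powers in `(q^(-n);q)_k`. -/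
theorem dualAltQCharlier_term (hq0 : 0 < q) (n m k : ℕ) :
    (List.map (fun x => qPoch x q k) [q ^ (-(m : ℤ)), -a * q ^ m, q ^ (-(n : ℤ))]).prod /
      ((List.map (fun x => qPoch x q k) []).prod * qPoch q q k) *
      ((-1) ^ k * q ^ (k * (k - 1) / 2)) ^
        (1 + (([] : List ℝ).length : ℤ) -
          ([q ^ (-(m : ℤ)), -a * q ^ m, q ^ (-(n : ℤ))].length : ℤ)) * (-q ^ n / a) ^ k =
      rowCoeff a q m k * qFalling q (q ^ n) k := by
  have e : (1 + (([] : List ℝ).length : ℤ) -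
      ([q ^ (-(m : ℤ)), -a * q ^ m, q ^ (-(n : ℤ))].length : ℤ)) = -((2 : ℕ) : ℤ) := by
    simp
  have e2 : ((-1 : ℝ) ^ k * q ^ (k * (k - 1) / 2)) ^ (-((2 : ℕ) : ℤ)) = (q ^ (k * (k - 1)))⁻¹ := by
    rw [zpow_neg, zpow_natCast, mul_pow, pow_half_sq, ← pow_mul, mul_comm k 2, pow_mul, neg_one_sq,
      one_pow, one_mul]
  rw [e, e2, ← qPoch_zpow_neg hq0.ne', show -q ^ n / a = -1 / a * q ^ n by ring, mul_pow]
  simp only [List.map_cons, List.map_nil, List.prod_cons, List.prod_nil, rowCoeff]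
  ring

/-- The series terminates on account of either index. Cutting at `m` gives a polynomial in `q^n`,
cutting at `n` one in `μ(m)`. -/
theorem dualAltQCharlier_eq_sum (hq0 : 0 < q) (n m : ℕ) {N : ℕ} (hN : n < N ∨ m < N) :
    dualAltQCharlier a q n m =
      ∑ k ∈ Finset.range N, rowCoeff a q m k * qFalling q (q ^ n) k := by
  unfold dualAltQCharlier basicHypergeometric
  simp_rw [dualAltQCharlier_term hq0]
  refine tsum_eq_sum fun k hk => ?_
  have hk' : N ≤ k := by simpa using hk
  rcases hN with h | h
  · rw [qFalling_eq_zero q (h.trans_le hk'), mul_zero]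
  · rw [rowCoeff_eq_zero hq0.ne' (h.trans_le hk'), zero_mul]

/-- The polynomial `∏_{i<k} (X - q^i)`. -/
noncomputable def qFallingPoly (q : ℝ) (k : ℕ) : ℝ[X] :=
  ∏ i ∈ Finset.range k, (X - C (q ^ i))

theorem eval_qFallingPoly (q x : ℝ) (k : ℕ) : (qFallingPoly q k).eval x = qFalling q x k := by
  simp [qFallingPoly, qFalling, eval_prod]

theorem monic_qFallingPoly (q : ℝ) (k : ℕ) : (qFallingPoly q k).Monic :=
  monic_prod_of_monic _ _ fun _ _ => monic_X_sub_C _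

theorem natDegree_qFallingPoly (q : ℝ) (k : ℕ) : (qFallingPoly q k).natDegree = k := by
  rw [qFallingPoly, natDegree_prod_of_monic _ _ fun i _ => monic_X_sub_C (q ^ i)]
  simp only [natDegree_X_sub_C, Finset.sum_const, Finset.card_range, smul_eq_mul, mul_one]

theorem degree_qFallingPoly (q : ℝ) (k : ℕ) : (qFallingPoly q k).degree = k := by
  rw [degree_eq_natDegree (monic_qFallingPoly q k).ne_zero, natDegree_qFallingPoly]

/-- A combination of polynomials of degrees `0, …, m` with nonzero last coefficient has
degree `m`. -/
theorem degree_sum_C_mul {S : ℕ → ℝ[X]} (hS : ∀ k, (S k).degree = k) (c : ℕ → ℝ) (m : ℕ)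
    (hc : c m ≠ 0) : (∑ k ∈ Finset.range (m + 1), C (c k) * S k).degree = m := by
  have h1 : (C (c m) * S m).degree = m := by rw [degree_C_mul hc, hS]
  rw [Finset.sum_range_succ, degree_add_eq_right_of_degree_lt, h1]
  rw [h1, degree_lt_iff_coeff_zero]
  intro j hj
  rw [finsetSum_coeff]
  refine Finset.sum_eq_zero fun k hk => ?_
  have : k < j := (Finset.mem_range.1 hk).trans_le hj
  rw [coeff_C_mul, coeff_eq_zero_of_degree_lt, mul_zero]
  rw [hS]
  exact_mod_cast this

/-- The alternative `q`-Charlier polynomial, normalized to give `d_n(μ(m); a; q)` at `q^n`. -/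
noncomputable def rowPoly (a q : ℝ) (m : ℕ) : ℝ[X] :=
  ∑ k ∈ Finset.range (m + 1), C (rowCoeff a q m k) * qFallingPoly q k

theorem eval_rowPoly_eq_sum (x : ℝ) (m : ℕ) : (rowPoly a q m).eval x =
    ∑ k ∈ Finset.range (m + 1), rowCoeff a q m k * qFalling q x k := by
  simp [rowPoly, eval_finsetSum, eval_qFallingPoly]

theorem eval_rowPoly (hq0 : 0 < q) (n m : ℕ) :
    (rowPoly a q m).eval (q ^ n) = dualAltQCharlier a q n m := by
  rw [eval_rowPoly_eq_sum, dualAltQCharlier_eq_sum hq0 n m (Or.inr m.lt_succ_self)]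

theorem qPoch_neg_pos (hq0 : 0 < q) (ha : 0 < a) (m k : ℕ) : 0 < qPoch (-a * q ^ m) q k := by
  refine Finset.prod_pos fun i _ => ?_
  have : 0 < a * q ^ m * q ^ i := by positivity
  linarith

theorem qFalling_self (q : ℝ) (m : ℕ) :
    qFalling q (q ^ m) m = (-1) ^ m * q ^ (m * (m - 1) / 2) * qPoch q q m := by
  induction m with
  | zero => simp [qFalling_zero, qPoch_zero]
  | succ m ih =>
    rw [pow_succ q m, qFalling_succ_mul, ih, qPoch_succ, Nat.triangle_succ, pow_add]
    ring

/-- The leading coefficient of the row polynomial is the source of `a^m q^(m(3m-1)/2)` in the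
weight. -/
theorem rowCoeff_self (hq0 : 0 < q) (hq1 : q < 1) (ha : 0 < a) (m : ℕ) :
    rowCoeff a q m m * (a ^ m * q ^ (m * (3 * m - 1) / 2)) = qPoch (-a * q ^ m) q m := by
  have h1 := (qPoch_self_pos hq0 hq1 m).ne'
  have h2 := qPoch_zpow_neg hq0.ne' m m
  rw [qFalling_self] at h2
  have e : m * (3 * m - 1) / 2 + m * (m - 1) / 2 = m * (m - 1) + m * m := by
    obtain ⟨c, hc⟩ := (Nat.even_mul_pred_self m)
    rcases m with _ | m
    · simp
    · rw [Nat.add_sub_cancel] at hc ⊢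
      have h3 : (m + 1) * (3 * (m + 1) - 1) = (c + (m + 1) * (m + 1)) * 2 := by
        rw [show 3 * (m + 1) - 1 = 3 * m + 2 by omega]
        nlinarith
      rw [h3, hc, ← mul_two, Nat.mul_div_cancel _ two_pos, Nat.mul_div_cancel _ two_pos]
      ring
  have e2 : q ^ (m * (3 * m - 1) / 2) * q ^ (m * (m - 1) / 2) = q ^ (m * (m - 1)) * (q ^ m) ^ m := by
    rw [← pow_add, e, pow_add, ← pow_mul]
  have h3 : q ^ (m * (m - 1)) ≠ 0 := by positivity
  have h4 : (q ^ m) ^ m ≠ 0 := by positivity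
  have h5 : qPoch (q ^ (-(m : ℤ))) q m =
      (-1) ^ m * q ^ (m * (m - 1) / 2) * qPoch q q m / (q ^ m) ^ m := by
    rw [← h2, mul_div_cancel_right₀ _ h4]
  unfold rowCoeff
  rw [h5, div_pow]
  generalize qPoch (-a * q ^ m) q m = B
  have h6 : ((-1 : ℝ) ^ m) * (-1) ^ m = 1 := by rw [← mul_pow]; simp
  field_simp
  calc _ = (((-1 : ℝ) ^ m) * (-1) ^ m) *
        (q ^ (m * (3 * m - 1) / 2) * q ^ (m * (m - 1) / 2)) * B := by ring
    _ = _ := by rw [h6, e2]; ring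

theorem rowCoeff_self_ne_zero (hq0 : 0 < q) (hq1 : q < 1) (ha : 0 < a) (m : ℕ) :
    rowCoeff a q m m ≠ 0 := by
  intro h
  have := rowCoeff_self hq0 hq1 ha m
  rw [h, zero_mul] at this
  exact (qPoch_neg_pos hq0 ha m m).ne this

theorem degree_rowPoly (hq0 : 0 < q) (hq1 : q < 1) (ha : 0 < a) (m : ℕ) :
    (rowPoly a q m).degree = m :=
  degree_sum_C_mul (degree_qFallingPoly q) _ m (rowCoeff_self_ne_zero hq0 hq1 ha m)

theorem coeff_rowPoly (m : ℕ) : (rowPoly a q m).coeff m = rowCoeff a q m m := by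
  rw [rowPoly, finsetSum_coeff, Finset.sum_range_succ, Finset.sum_eq_zero, zero_add, coeff_C_mul]
  · have h := monic_qFallingPoly q m
    rw [Monic, leadingCoeff, natDegree_qFallingPoly] at h
    rw [h, mul_one]
  · intro k hk
    rw [coeff_C_mul, coeff_eq_zero_of_degree_lt, mul_zero]
    rw [degree_qFallingPoly]
    exact_mod_cast Finset.mem_range.1 hk

/-- Weighted by `rowCoeff`, the factorial moments form a q-Chu–Vandermonde sum with `b = -a q^m` and
`u = q^(l+1-m)`, times a common infinite product. -/
theorem hasSum_rowPoly_mul_pow (hq0 : 0 < q) (hq1 : q < 1) (ha : 0 < a) (m l : ℕ) :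
    HasSum (fun n => charlierWeight a q n * ((rowPoly a q m).eval (q ^ n) * (q ^ n) ^ l))
      (qPoch (q ^ ((l : ℤ) + 1 - m)) q m * qPochInf (-a * q ^ (m + l + 1)) q) := by
  have h := hasSum_sum (s := Finset.range (m + 1)) fun k _ =>
    (hasSum_charlierWeight_mul_qFalling hq0 hq1 ha k l).mul_left (rowCoeff a q m k)
  have e : ∑ k ∈ Finset.range (m + 1), rowCoeff a q m k *
      ((-a) ^ k * q ^ (k * k + k * l) * qPochInf (-a * q ^ (k + l + 1)) q) =
      qPoch (q ^ ((l : ℤ) + 1 - m)) q m * qPochInf (-a * q ^ (m + l + 1)) q := by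
    rw [← qVandermonde hq0 hq1 m (-a * q ^ m), Finset.sum_mul]
    refine Finset.sum_congr rfl fun k hk => ?_
    have hk' : k ≤ m := Nat.lt_succ_iff.1 (Finset.mem_range.1 hk)
    have hu : q ^ m * q ^ ((l : ℤ) + 1 - m) = q ^ (l + 1) := by
      rw [← zpow_natCast, ← zpow_add₀ hq0.ne', ← zpow_natCast]
      congr 1
      push_cast
      ring
    have h1 : -a * q ^ m * q ^ ((l : ℤ) + 1 - m) * q ^ k = -a * q ^ (k + l + 1) := by
      rw [mul_assoc (-a), hu]; ring
    have h2 : -a * q ^ (k + l + 1) * q ^ (m - k) = -a * q ^ (m + l + 1) := by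
      rw [mul_assoc, ← pow_add]
      congr 2
      omega
    rw [h1, qPochInf_eq_mul hq0 hq1 (-a * q ^ (k + l + 1)) (m - k), h2, qFallingQuot,
      ← qPoch_zpow_neg hq0.ne', rowCoeff, div_pow]
    have h3 : (q ^ m) ^ k * (q ^ ((l : ℤ) + 1 - m)) ^ k = q ^ (k * l) * q ^ k := by
      rw [← mul_pow, hu]; ring
    have h4 : q ^ (k * k + k * l) = q ^ (k * (k - 1)) * (q ^ (k * l) * q ^ k) := by
      rw [← pow_add, ← pow_add]
      congr 1
      rcases k with _ | k
      · simp
      · rw [Nat.add_sub_cancel]; ring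
    have h5 : (-a) ^ k * (-1) ^ k = a ^ k := by rw [← mul_pow]; simp
    have h6 : qPoch q q k ≠ 0 := (qPoch_self_pos hq0 hq1 k).ne'
    have h7 : q ^ (k * (k - 1)) ≠ 0 := by positivity
    rw [h4, ← h3]
    field_simp
    rw [← h5]
    ring
  rw [e] at h
  refine h.congr_fun fun n => ?_
  rw [eval_rowPoly_eq_sum, Finset.sum_mul, Finset.mul_sum]
  exact Finset.sum_congr rfl fun k _ => by ring

theorem hasSum_rowPoly_mul (hq0 : 0 < q) (hq1 : q < 1) (ha : 0 < a) {m : ℕ} {Q : ℝ[X]}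
    (hQ : Q.natDegree ≤ m) :
    HasSum (fun n => charlierWeight a q n * ((rowPoly a q m).eval (q ^ n) * Q.eval (q ^ n)))
      (Q.coeff m * (qPoch q q m * qPochInf (-a * q ^ (2 * m + 1)) q)) := by
  have h := hasSum_sum (s := Finset.range (m + 1)) fun l _ =>
    (hasSum_rowPoly_mul_pow hq0 hq1 ha m l).mul_left (Q.coeff l)
  rw [Finset.sum_range_succ, Finset.sum_eq_zero, zero_add] at h
  · rw [show (m : ℤ) + 1 - m = 1 by ring, zpow_one, ← two_mul] at h
    refine h.congr_fun fun n => ?_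
    rw [eval_eq_sum_range' (Nat.lt_succ_of_le hQ), Finset.mul_sum, Finset.mul_sum]
    exact Finset.sum_congr rfl fun k _ => by ring
  · intro l hl
    have hl' : l < m := Finset.mem_range.1 hl
    -- For `l < m` the factor of index `m - 1 - l` is `1 - q^0`.
    have : qPoch (q ^ ((l : ℤ) + 1 - m)) q m = 0 := by
      refine Finset.prod_eq_zero (Finset.mem_range.2 (show m - 1 - l < m by omega)) ?_
      rw [← zpow_natCast, ← zpow_add₀ hq0.ne',
        show (l : ℤ) + 1 - m + ((m - 1 - l : ℕ) : ℤ) = 0 by omega, zpow_zero, sub_self]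
    rw [this]
    ring

theorem dualWeight_pos (hq0 : 0 < q) (hq1 : q < 1) (ha : 0 < a) (m : ℕ) :
    0 < dualWeight a q m := by
  have h1 := qPoch_self_pos hq0 hq1 m
  have h2 := qPochInf_pos hq0 hq1 ha m
  unfold dualWeight
  positivity

theorem rowPoly_norm_sq (hq0 : 0 < q) (hq1 : q < 1) (ha : 0 < a) (m : ℕ) :
    rowCoeff a q m m * (qPoch q q m * qPochInf (-a * q ^ (2 * m + 1)) q) =
      (dualWeight a q m)⁻¹ := by
  have h1 := (qPoch_self_pos hq0 hq1 m).ne'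
  have h2 := (qPochInf_pos hq0 hq1 ha m).ne'
  -- Splitting off `m + 1` factors rather than `m` exposes the last one, `1 + a q^(2m)`, which is
  -- the factor in the weight.
  have h3 := qPochInf_eq_mul hq0 hq1 (-a * q ^ m) (m + 1)
  rw [qPoch_succ, show -a * q ^ m * q ^ (m + 1) = -a * q ^ (2 * m + 1) by ring,
    ← rowCoeff_self hq0 hq1 ha, show -a * q ^ m * q ^ m = -a * q ^ (2 * m) by ring] at h3
  refine eq_inv_of_mul_eq_one_left ?_
  unfold dualWeight
  generalize qPochInf (-a * q ^ m) q = A at *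
  generalize qPochInf (-a * q ^ (2 * m + 1)) q = B at *
  field_simp
  rw [h3]
  ring

/-- Orthogonality of the alternative `q`-Charlier polynomials. -/
theorem hasSum_dualAltQCharlier_row (hq0 : 0 < q) (hq1 : q < 1) (ha : 0 < a) (m m' : ℕ) :
    HasSum (fun n => charlierWeight a q n * (dualAltQCharlier a q n m * dualAltQCharlier a q n m'))
      (if m = m' then (dualWeight a q m)⁻¹ else 0) := by
  have hd := fun m => natDegree_eq_of_degree_eq_some (degree_rowPoly hq0 hq1 ha m)
  rcases lt_trichotomy m m' with h | rfl | h
  · have := hasSum_rowPoly_mul hq0 hq1 ha ((hd m).trans_le h.le)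
    rw [coeff_eq_zero_of_natDegree_lt ((hd m).trans_lt h), zero_mul] at this
    simp only [eval_rowPoly hq0] at this
    rw [if_neg h.ne]
    exact this.congr_fun fun n => by ring
  · have := hasSum_rowPoly_mul hq0 hq1 ha (hd m).le
    rw [coeff_rowPoly, rowPoly_norm_sq hq0 hq1 ha] at this
    simp only [eval_rowPoly hq0] at this
    rwa [if_pos rfl]
  · have := hasSum_rowPoly_mul hq0 hq1 ha ((hd m').trans_le h.le)
    rw [coeff_eq_zero_of_natDegree_lt ((hd m').trans_lt h), zero_mul] at this
    simp only [eval_rowPoly hq0] at this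
    rwa [if_neg h.ne']

/-- A sequence of polynomials with degrees `0, 1, 2, …` spans all polynomials. -/
theorem span_range_eq_top {S : ℕ → ℝ[X]} (hS : ∀ k, (S k).degree = k) :
    Submodule.span ℝ (Set.range S) = ⊤ :=
  Polynomial.Sequence.span ⟨S, hS⟩ fun i =>
    (leadingCoeff_ne_zero.2 (Polynomial.Sequence.ne_zero ⟨S, hS⟩ i)).isUnit

/-- A summable sequence annihilated by all powers `(q^n)^l` vanishes. -/
theorem eq_zero_of_hasSum_mul_pow (hq0 : 0 < q) (hq1 : q < 1) {h : ℕ → ℂ}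
    (hs : Summable fun n => ‖h n‖) (h0 : ∀ l : ℕ, HasSum (fun n => ((q ^ n) ^ l) • h n) 0)
    (n : ℕ) : h n = 0 := by
  induction n using Nat.strong_induction_on with
  | _ k ih =>
    -- With the terms before `k` zero, dividing by `(q^k)^l` shows that the shifted sums vanish for
    -- every `l`, while they tend to `h k`.
    have ht := tendsto_tsum_mul_pow hq0 hq1 (h := fun n => h (n + k))
      ((summable_nat_add_iff k).2 hs)
    rw [zero_add] at ht
    refine tendsto_nhds_unique ht (tendsto_const_nhds.congr fun l => ?_)
    have h1 := (h0 l).summable.sum_add_tsum_nat_add k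
    rw [(h0 l).tsum_eq, Finset.sum_eq_zero, zero_add] at h1
    · have h2 : ∑' n, ((q ^ (n + k)) ^ l) • h (n + k) =
          ((q ^ k) ^ l) • ∑' n, ((q ^ n) ^ l) • h (n + k) := by
        rw [← tsum_const_smul'' ((q ^ k) ^ l)]
        refine tsum_congr fun n => ?_
        rw [smul_smul]
        congr 1
        ring
      rw [h2] at h1
      exact ((smul_eq_zero.1 h1).resolve_left (by positivity)).symm
    · intro i hi
      rw [ih i (Finset.mem_range.1 hi), smul_zero]

/-- Annihilation is linear in the polynomial and the row polynomials span, so it passes to the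
monomials. -/
theorem eq_zero_of_hasSum_dualAltQCharlier (hq0 : 0 < q) (hq1 : q < 1) (ha : 0 < a) {h : ℕ → ℂ}
    (hs : Summable fun n => ‖h n‖)
    (h0 : ∀ m : ℕ, HasSum (fun n => dualAltQCharlier a q n m • h n) 0) (n : ℕ) : h n = 0 := by
  have key : ∀ Q : ℝ[X], HasSum (fun n => Q.eval (q ^ n) • h n) 0 := by
    intro Q
    have hQ : Q ∈ Submodule.span ℝ (Set.range (rowPoly a q)) := by
      rw [span_range_eq_top (degree_rowPoly hq0 hq1 ha)]
      trivial
    induction hQ using Submodule.span_induction with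
    | mem x hx =>
      obtain ⟨m, rfl⟩ := hx
      simpa only [eval_rowPoly hq0] using h0 m
    | zero => simp
    | add x y _ _ hx hy => simpa [add_smul] using hx.add hy
    | smul c x _ hx => simpa [mul_assoc] using hx.const_smul c
  refine eq_zero_of_hasSum_mul_pow hq0 hq1 hs (fun l => ?_) n
  simpa using key (X ^ l)

end RowPolynomials

/-! ### From complete orthonormal rows to complete orthonormal columns. -/

section UnitaryMatrix

/-- A real matrix whose rows form a complete orthonormal system of `ℓ²` gives a Hilbert basis. -/
theorem exists_hilbertBasis_of_rows {U : ℕ → ℕ → ℝ}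
    (hrow : ∀ m m', HasSum (fun n => U m n * U m' n) (if m = m' then 1 else 0))
    (hcomplete : ∀ v : ℕ → ℂ, (Summable fun n => ‖v n‖ ^ 2) →
      (∀ m, HasSum (fun n => U m n • v n) 0) → ∀ n, v n = 0) :
    ∃ b : HilbertBasis ℕ ℂ (lp (fun _ : ℕ => ℂ) 2), ∀ m n, b m n = U m n := by
  have hmem : ∀ m, Memℓp (fun n => (U m n : ℂ)) 2 := by
    intro m
    refine memℓp_gen ?_
    simpa [sq] using (hrow m m).summable
  set r : ℕ → lp (fun _ : ℕ => ℂ) 2 := fun m => ⟨fun n => (U m n : ℂ), hmem m⟩ with hr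
  have hinner : ∀ m m', inner ℂ (r m) (r m') = if m = m' then 1 else 0 := by
    intro m m'
    refine (lp.hasSum_inner (𝕜 := ℂ) (r m) (r m')).unique ?_
    have h := Complex.hasSum_ofReal.2 (hrow m m')
    convert! h using 1
    · funext n
      simp [hr, mul_comm]
    · split_ifs <;> simp
  have hon : Orthonormal ℂ r := orthonormal_iff_ite.2 hinner
  have hbot : (Submodule.span ℂ (Set.range r))ᗮ = ⊥ := by
    rw [Submodule.eq_bot_iff]
    intro v hv
    have hz : ∀ n, v n = 0 := by
      refine hcomplete v ?_ fun m => ?_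
      · simpa using (lp.memℓp v).summable (by norm_num)
      · have h := lp.hasSum_inner (𝕜 := ℂ) (r m) v
        rw [(Submodule.mem_orthogonal _ _).1 hv (r m) (Submodule.subset_span ⟨m, rfl⟩)] at h
        simpa [hr, mul_comm] using h
    ext n
    simpa using hz n
  refine ⟨HilbertBasis.mkOfOrthogonalEqBot hon hbot, fun m n => ?_⟩
  rw [HilbertBasis.coe_mkOfOrthogonalEqBot]

variable {U : ℕ → ℕ → ℝ} {b : HilbertBasis ℕ ℂ (lp (fun _ : ℕ => ℂ) 2)}

theorem inner_single_hilbertBasis (hb : ∀ m n, b m n = U m n) (m n : ℕ) :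
    inner ℂ (lp.single 2 n (1 : ℂ) : lp (fun _ : ℕ => ℂ) 2) (b m) = U m n := by
  rw [lp.inner_single_left, hb]
  simp

/-- The columns of a unitary matrix are orthonormal. -/
theorem hasSum_columns (hb : ∀ m n, b m n = U m n) (n k : ℕ) :
    HasSum (fun m => U m n * U m k) (if n = k then 1 else 0) := by
  -- Parseval for two standard unit vectors, whose coordinates in `b` are columns of `U`.
  have h := b.hasSum_inner_mul_inner (lp.single 2 n (1 : ℂ)) (lp.single 2 k (1 : ℂ))
  rw [lp.inner_single_left] at h
  rw [← Complex.hasSum_ofReal]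
  convert! h using 1
  · funext m
    rw [inner_single_hilbertBasis hb, ← inner_conj_symm, inner_single_hilbertBasis hb]
    simp
  · rw [lp.single_apply, Pi.single_apply]
    split_ifs <;> simp

/-- The columns of a unitary matrix are complete. -/
theorem eq_zero_of_hasSum_columns (hb : ∀ m n, b m n = U m n) {v : ℕ → ℂ}
    (hv : Summable fun m => ‖v m‖ ^ 2) (h0 : ∀ n, HasSum (fun m => U m n • v m) 0) (m : ℕ) :
    v m = 0 := by
  set V : lp (fun _ : ℕ => ℂ) 2 := ⟨v, memℓp_gen (by simpa using hv)⟩ with hV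
  -- The vector with coordinates `v` in the basis `b` has `n`-th entry `∑ₘ U m n v m`, which is zero
  -- by hypothesis.
  have hx : b.repr.symm V = 0 := by
    ext n
    have h := b.hasSum_inner_mul_inner (lp.single 2 n (1 : ℂ)) (b.repr.symm V)
    simp_rw [inner_single_hilbertBasis hb, ← b.repr_apply_apply,
      LinearIsometryEquiv.apply_symm_apply] at h
    have h2 := h.unique (by simpa [hV] using h0 n)
    rw [lp.inner_single_left] at h2
    simpa using h2
  have hV0 : V = 0 := by simpa using hx
  exact congrFun (congrArg (fun f : lp (fun _ : ℕ => ℂ) 2 => (f : ℕ → ℂ)) hV0) m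

end UnitaryMatrix

/-! ### The unitary matrix of the problem and the dual relations. -/

section Columns

variable {a q : ℝ}

theorem exists_hilbertBasis_dualAltQCharlier (hq0 : 0 < q) (hq1 : q < 1) (ha : 0 < a) :
    ∃ b : HilbertBasis ℕ ℂ (lp (fun _ : ℕ => ℂ) 2), ∀ m n, b m n =
      ((√(dualWeight a q m) * √(charlierWeight a q n) * dualAltQCharlier a q n m : ℝ) : ℂ) := by
  have hw := dualWeight_pos hq0 hq1 ha
  have hp := charlierWeight_pos hq0 hq1 ha
  refine exists_hilbertBasis_of_rows
    (U := fun m n => √(dualWeight a q m) * √(charlierWeight a q n) * dualAltQCharlier a q n m)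
    (fun m m' => ?_) fun v hv h0 n => ?_
  · have h := (hasSum_dualAltQCharlier_row hq0 hq1 ha m m').mul_left
      (√(dualWeight a q m) * √(dualWeight a q m'))
    have e : √(dualWeight a q m) * √(dualWeight a q m') *
        (if m = m' then (dualWeight a q m)⁻¹ else 0) = if m = m' then 1 else 0 := by
      split_ifs with hm
      · rw [← hm, Real.mul_self_sqrt (hw m).le, mul_inv_cancel₀ (hw m).ne']
      · rw [mul_zero]
    rw [e] at h
    refine h.congr_fun fun n => ?_
    rw [← Real.mul_self_sqrt (hp n).le]
    simp only [Real.sqrt_mul_self (Real.sqrt_nonneg _)]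
    ring
  -- Row completeness needs absolute summability; for `v` in `ℓ²` it follows from `√p |v| ≤ p +
  -- |v|²` and summability of `p`.
  · have hs : Summable fun n => ‖√(charlierWeight a q n) • v n‖ := by
      refine ((summable_charlierWeight hq0 hq1 ha).add hv).of_nonneg_of_le
        (fun n => norm_nonneg _) fun n => ?_
      rw [norm_smul, Real.norm_of_nonneg (Real.sqrt_nonneg _)]
      have h1 := Real.mul_self_sqrt (hp n).le
      nlinarith [sq_nonneg (√(charlierWeight a q n) - ‖v n‖), Real.sqrt_nonneg (charlierWeight a q n),
        norm_nonneg (v n), mul_nonneg (Real.sqrt_nonneg (charlierWeight a q n)) (norm_nonneg (v n))]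
    have hz := eq_zero_of_hasSum_dualAltQCharlier hq0 hq1 ha hs (fun m => ?_) n
    · exact (smul_eq_zero.1 hz).resolve_left (Real.sqrt_pos.2 (hp n)).ne'
    · have h := (h0 m).const_smul (√(dualWeight a q m))⁻¹
      rw [smul_zero] at h
      refine h.congr_fun fun n => ?_
      have hne := (Real.sqrt_pos.2 (hw m)).ne'
      rw [smul_smul, smul_smul]
      congr 1
      field_simp

/-- Orthogonality of the dual alternative `q`-Charlier polynomials. -/
theorem hasSum_dualAltQCharlier_column (hq0 : 0 < q) (hq1 : q < 1) (ha : 0 < a) (n k : ℕ) :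
    HasSum (fun m => dualWeight a q m * (dualAltQCharlier a q n m * dualAltQCharlier a q k m))
      (if n = k then (charlierWeight a q n)⁻¹ else 0) := by
  have hw := dualWeight_pos hq0 hq1 ha
  have hp := charlierWeight_pos hq0 hq1 ha
  obtain ⟨b, hb⟩ := exists_hilbertBasis_dualAltQCharlier hq0 hq1 ha
  have h := (hasSum_columns hb n k).mul_left (√(charlierWeight a q n) * √(charlierWeight a q k))⁻¹
  have e : (√(charlierWeight a q n) * √(charlierWeight a q k))⁻¹ * (if n = k then 1 else 0) =
      if n = k then (charlierWeight a q n)⁻¹ else 0 := by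
    split_ifs with hm
    · rw [← hm, Real.mul_self_sqrt (hp n).le, mul_one]
    · rw [mul_zero]
  rw [e] at h
  refine h.congr_fun fun m => ?_
  have h1 := (Real.sqrt_pos.2 (hp n)).ne'
  have h2 := (Real.sqrt_pos.2 (hp k)).ne'
  have h3 := Real.mul_self_sqrt (hw m).le
  rw [eq_inv_mul_iff_mul_eq₀ (mul_ne_zero h1 h2), ← h3]
  simp only [Real.sqrt_mul_self (Real.sqrt_nonneg _)]
  ring

theorem eq_zero_of_hasSum_dualAltQCharlier_column (hq0 : 0 < q) (hq1 : q < 1) (ha : 0 < a)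
    {f : ℕ → ℂ} (hf : Summable fun m => dualWeight a q m * ‖f m‖ ^ 2)
    (h0 : ∀ n, HasSum (fun m => (dualWeight a q m * dualAltQCharlier a q n m) • f m) 0) (m : ℕ) :
    f m = 0 := by
  have hw := dualWeight_pos hq0 hq1 ha
  obtain ⟨b, hb⟩ := exists_hilbertBasis_dualAltQCharlier hq0 hq1 ha
  have hz := eq_zero_of_hasSum_columns hb (v := fun m => √(dualWeight a q m) • f m) ?_ ?_ m
  · exact (smul_eq_zero.1 hz).resolve_left (Real.sqrt_pos.2 (hw m)).ne'
  · refine hf.congr fun m => ?_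
    rw [norm_smul, mul_pow, Real.norm_of_nonneg (Real.sqrt_nonneg _), Real.sq_sqrt (hw m).le]
  · intro n
    have h := (h0 n).const_smul √(charlierWeight a q n)
    rw [smul_zero] at h
    refine h.congr_fun fun m => ?_
    rw [smul_smul, smul_smul]
    congr 1
    have h3 := Real.mul_self_sqrt (hw m).le
    rw [← h3]
    simp only [Real.sqrt_mul_self (Real.sqrt_nonneg _)]
    ring

end Columns

/-! ### `L²` spaces of discrete measures as weighted sequence spaces. -/

section PointMeasures

variable {α : Type*} [MeasurableSpace α] [MeasurableSingletonClass α] {w : ℕ → ℝ} {x : ℕ → α}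
  {ν : Measure α}

/-- Every atom has positive mass, so none is negligible; this makes the values of `Lp` classes at
the atoms meaningful. -/
theorem ae_sum_dirac_iff (hw : ∀ m, 0 < w m)
    (hν : ν = Measure.sum fun m => ENNReal.ofReal (w m) • Measure.dirac (x m)) {P : α → Prop} :
    (∀ᵐ y ∂ν, P y) ↔ ∀ m, P (x m) := by
  subst hν
  rw [Measure.ae_sum_iff]
  refine forall_congr' fun m => ?_
  rw [Measure.ae_ennreal_smul_measure_iff (by simpa using hw m), ae_dirac_eq, eventually_pure]

theorem memLp_two_sum_dirac (hw : ∀ m, 0 < w m)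
    (hν : ν = Measure.sum fun m => ENNReal.ofReal (w m) • Measure.dirac (x m)) {f : α → ℂ}
    (hf : Summable fun m => w m * ‖f (x m)‖ ^ 2) : MemLp f 2 ν := by
  subst hν
  refine (memLp_two_iff_integrable_sq_norm ?_).2 ?_
  · exact aestronglyMeasurable_sum_measure_iff.2 fun m =>
      aestronglyMeasurable_dirac.mono_ac Measure.smul_absolutelyContinuous
  · refine integrable_sum_dirac (fun _ => ENNReal.ofReal_ne_top) ?_
    simpa [ENNReal.toReal_ofReal (hw _).le] using hf

theorem summable_sq_norm_of_memLp_sum_dirac (hw : ∀ m, 0 < w m)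
    (hν : ν = Measure.sum fun m => ENNReal.ofReal (w m) • Measure.dirac (x m)) {f : α → ℂ}
    (hf : MemLp f 2 ν) : Summable fun m => w m * ‖f (x m)‖ ^ 2 := by
  subst hν
  have h := ((memLp_two_iff_integrable_sq_norm hf.1).1 hf).summable_of_dirac
  simpa [ENNReal.toReal_ofReal (hw _).le] using h

theorem hasSum_integral_sum_dirac {E : Type*} [NormedAddCommGroup E] [NormedSpace ℝ E]
    [CompleteSpace E] (hw : ∀ m, 0 < w m)
    (hν : ν = Measure.sum fun m => ENNReal.ofReal (w m) • Measure.dirac (x m)) {f : α → E}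
    (hf : Integrable f ν) : HasSum (fun m => w m • f (x m)) (∫ y, f y ∂ν) := by
  subst hν
  refine (hasSum_integral_measure hf).congr_fun fun m => ?_
  rw [integral_smul_measure, integral_dirac, ENNReal.toReal_ofReal (hw m).le]

theorem hasSum_inner_sum_dirac (hw : ∀ m, 0 < w m)
    (hν : ν = Measure.sum fun m => ENNReal.ofReal (w m) • Measure.dirac (x m)) (f g : Lp ℂ 2 ν) :
    HasSum (fun m => w m • inner ℂ (f (x m)) (g (x m))) (inner ℂ f g) := by
  rw [L2.inner_def]
  have hi := L2.integrable_inner (𝕜 := ℂ) f g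
  have h := hasSum_integral_sum_dirac hw hν hi
  exact h

end PointMeasures

/-! ### Orthogonal basis, lattice polynomials, moments and extremality. -/

section Main

variable {a q : ℝ}

theorem dualAltQCharlier_zero (hq0 : 0 < q) (m : ℕ) : dualAltQCharlier a q 0 m = 1 := by
  rw [dualAltQCharlier_eq_sum hq0 0 m (Or.inl one_pos)]
  simp [rowCoeff, qPoch_zero, qFalling_zero]

/-- The vectors with values `d_n(μ(m); a; q)` span a dense subspace of any `L²` space of a point
measure with masses `dualWeight a q m`. -/
theorem topologicalClosure_eq_top_of_dualAltQCharlier {α : Type*} [MeasurableSpace α]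
    [MeasurableSingletonClass α] {x : ℕ → α} {ν : Measure α}
    (hq0 : 0 < q) (hq1 : q < 1) (ha : 0 < a)
    (hν : ν = Measure.sum fun m => ENNReal.ofReal (dualWeight a q m) • Measure.dirac (x m))
    (S : Submodule ℂ (Lp ℂ 2 ν))
    (hS : ∀ n, ∃ g ∈ S, ∀ m, g (x m) = (dualAltQCharlier a q n m : ℂ)) :
    S.topologicalClosure = ⊤ := by
  have hw := dualWeight_pos hq0 hq1 ha
  rw [Submodule.topologicalClosure_eq_top_iff, Submodule.eq_bot_iff]
  intro f hf
  have hz := eq_zero_of_hasSum_dualAltQCharlier_column hq0 hq1 ha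
    (summable_sq_norm_of_memLp_sum_dirac hw hν (Lp.memLp f)) fun n => by
      obtain ⟨g, hg, hgx⟩ := hS n
      have h := hasSum_inner_sum_dirac hw hν g f
      rw [(Submodule.mem_orthogonal _ _).1 hf g hg] at h
      refine h.congr_fun fun m => ?_
      rw [hgx, mul_smul]
      simp [mul_comm]
  rw [Lp.eq_zero_iff_ae_eq_zero]
  exact (ae_sum_dirac_iff hw hν).2 hz

theorem summable_dualWeight_mul_sq (hq0 : 0 < q) (hq1 : q < 1) (ha : 0 < a) (n : ℕ) :
    Summable fun m => dualWeight a q m * ‖(dualAltQCharlier a q n m : ℂ)‖ ^ 2 := by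
  refine (hasSum_dualAltQCharlier_column hq0 hq1 ha n n).summable.congr fun m => ?_
  rw [Complex.norm_real, Real.norm_eq_abs, sq_abs, sq]

theorem charlierWeight_inv (a q : ℝ) (n : ℕ) :
    (charlierWeight a q n)⁻¹ = qPoch q q n / (a ^ n * q ^ (n * (n + 1) / 2)) := by
  rw [charlierWeight, inv_div]

/-- The functions `m ↦ d_n(μ(m); a; q)` as elements of the weighted `ℓ²`-space. -/
theorem exists_dualL2_orthogonalBasis (hq0 : 0 < q) (hq1 : q < 1) (ha : 0 < a) :
    ∃ D : ℕ → DualL2 a q,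
      (∀ n m : ℕ, D n m = (dualAltQCharlier a q n m : ℂ)) ∧
      (∀ n k : ℕ, inner ℂ (D n) (D k) =
        if n = k then ((qPoch q q n / (a ^ n * q ^ (n * (n + 1) / 2)) : ℝ) : ℂ) else 0) ∧
      IsOrthogonalBasis D := by
  have hw := dualWeight_pos hq0 hq1 ha
  have hν : dualIndexMeasure a q =
      Measure.sum fun m => ENNReal.ofReal (dualWeight a q m) • Measure.dirac (id m) := rfl
  have hmem : ∀ n, MemLp (fun m => (dualAltQCharlier a q n m : ℂ)) 2 (dualIndexMeasure a q) :=
    fun n => memLp_two_sum_dirac hw hν (summable_dualWeight_mul_sq hq0 hq1 ha n)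
  set D : ℕ → DualL2 a q := fun n => (hmem n).toLp _ with hD
  have hval : ∀ n m : ℕ, D n m = (dualAltQCharlier a q n m : ℂ) := fun n m =>
    (ae_sum_dirac_iff hw hν (P := fun m => D n m = (dualAltQCharlier a q n m : ℂ))).1
      (hmem n).coeFn_toLp m
  have hinner : ∀ n k : ℕ, inner ℂ (D n) (D k) =
      if n = k then ((qPoch q q n / (a ^ n * q ^ (n * (n + 1) / 2)) : ℝ) : ℂ) else 0 := by
    intro n k
    refine (hasSum_inner_sum_dirac hw hν (D n) (D k)).unique ?_
    have h := Complex.hasSum_ofReal.2 (hasSum_dualAltQCharlier_column hq0 hq1 ha n k)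
    rw [charlierWeight_inv] at h
    convert! h using 1
    · funext m
      simp only [id, hval]
      simp [mul_comm]
    · split_ifs <;> simp
  refine ⟨D, hval, hinner, fun n h0 => ?_, fun n k hnk => ?_, ?_⟩
  · have h := hinner n n
    rw [h0, inner_zero_left, if_pos rfl, ← charlierWeight_inv] at h
    exact (inv_pos.2 (charlierWeight_pos hq0 hq1 ha n)).ne (by exact_mod_cast h)
  · rw [hinner, if_neg hnk]
  · exact topologicalClosure_eq_top_of_dualAltQCharlier hq0 hq1 ha hν _
      fun n => ⟨D n, Submodule.subset_span ⟨n, rfl⟩, hval n⟩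

/-- The polynomial `∏_{i<k} (1 - a q^(2i) - q^i X)`, with value `(q^(-m);q)_k (-a q^m;q)_k`
at `μ(m)`. -/
noncomputable def latticePoly (a q : ℝ) (k : ℕ) : ℝ[X] :=
  ∏ i ∈ Finset.range k, (C (-q ^ i) * X + C (1 - a * q ^ (2 * i)))

theorem degree_latticePoly (hq : q ≠ 0) (k : ℕ) : (latticePoly a q k).degree = k := by
  rw [latticePoly, degree_prod, Finset.sum_congr rfl fun i _ =>
    degree_linear (neg_ne_zero.2 (pow_ne_zero i hq))]
  simp

theorem eval_latticePoly (hq : q ≠ 0) (m k : ℕ) : (latticePoly a q k).eval (qLattice a q m) =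
    qPoch (q ^ (-(m : ℤ))) q k * qPoch (-a * q ^ m) q k := by
  rw [latticePoly, eval_prod, qPoch, qPoch, ← Finset.prod_mul_distrib]
  refine Finset.prod_congr rfl fun i _ => ?_
  simp only [eval_add, eval_mul, eval_C, eval_X, qLattice, zpow_neg, zpow_natCast]
  field_simp
  ring

/-- The dual alternative `q`-Charlier polynomial of degree `n`. -/
noncomputable def dualAltQCharlierPoly (a q : ℝ) (n : ℕ) : ℝ[X] :=
  ∑ k ∈ Finset.range (n + 1),
    C (qFalling q (q ^ n) k / qPoch q q k * ((q ^ (k * (k - 1)))⁻¹ * (-1 / a) ^ k)) *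
      latticePoly a q k

theorem eval_dualAltQCharlierPoly (hq0 : 0 < q) (n m : ℕ) :
    (dualAltQCharlierPoly a q n).eval (qLattice a q m) = dualAltQCharlier a q n m := by
  rw [dualAltQCharlierPoly, eval_finsetSum,
    dualAltQCharlier_eq_sum hq0 n m (Or.inl n.lt_succ_self)]
  refine Finset.sum_congr rfl fun k _ => ?_
  rw [eval_mul, eval_C, eval_latticePoly hq0.ne', rowCoeff]
  ring

theorem degree_dualAltQCharlierPoly (hq0 : 0 < q) (hq1 : q < 1) (ha : 0 < a) (n : ℕ) :
    (dualAltQCharlierPoly a q n).degree = n := by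
  refine degree_sum_C_mul (degree_latticePoly hq0.ne')
    (fun k => qFalling q (q ^ n) k / qPoch q q k * ((q ^ (k * (k - 1)))⁻¹ * (-1 / a) ^ k)) n ?_
  have h1 := (qPoch_self_pos hq0 hq1 n).ne'
  have h2 : -1 / a ≠ 0 := div_ne_zero (by norm_num) ha.ne'
  rw [qFalling_self]
  have h3 : (-1 : ℝ) ^ n ≠ 0 := pow_ne_zero _ (by norm_num)
  have h4 := hq0.ne'
  positivity

theorem integrable_dualAltQCharlierPoly_mul (hq0 : 0 < q) (hq1 : q < 1) (ha : 0 < a) (n k : ℕ) :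
    Integrable (fun x => (dualAltQCharlierPoly a q n).eval x * (dualAltQCharlierPoly a q k).eval x)
      (dualPointMeasure a q) := by
  refine integrable_sum_dirac (fun _ => ENNReal.ofReal_ne_top) ?_
  refine (hasSum_dualAltQCharlier_column hq0 hq1 ha n k).summable.norm.congr fun m => ?_
  have hw := (dualWeight_pos hq0 hq1 ha m).le
  rw [eval_dualAltQCharlierPoly hq0, eval_dualAltQCharlierPoly hq0, norm_mul,
    ENNReal.toReal_ofReal hw, Real.norm_of_nonneg hw]

theorem integral_dualAltQCharlierPoly_mul (hq0 : 0 < q) (hq1 : q < 1) (ha : 0 < a) (n k : ℕ) :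
    ∫ x, (dualAltQCharlierPoly a q n).eval x * (dualAltQCharlierPoly a q k).eval x
      ∂(dualPointMeasure a q) = if n = k then (charlierWeight a q n)⁻¹ else 0 := by
  have h := hasSum_integral_sum_dirac (dualWeight_pos hq0 hq1 ha) rfl
    (integrable_dualAltQCharlierPoly_mul hq0 hq1 ha n k)
  simp only [eval_dualAltQCharlierPoly hq0] at h
  exact h.unique (hasSum_dualAltQCharlier_column hq0 hq1 ha n k)

theorem integrable_pow_dualPointMeasure (hq0 : 0 < q) (hq1 : q < 1) (ha : 0 < a) (k : ℕ) :
    Integrable (fun x : ℝ => x ^ k) (dualPointMeasure a q) := by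
  have key : ∀ Q : ℝ[X], Integrable (fun x => Q.eval x) (dualPointMeasure a q) := by
    intro Q
    have hQ : Q ∈ Submodule.span ℝ (Set.range (dualAltQCharlierPoly a q)) := by
      rw [span_range_eq_top (degree_dualAltQCharlierPoly hq0 hq1 ha)]
      trivial
    induction hQ using Submodule.span_induction with
    | mem x hx =>
      obtain ⟨n, rfl⟩ := hx
      -- Since `d_0 = 1` on the lattice, a single polynomial agrees almost everywhere with its
      -- product with the one of index 0.
      have h := integrable_dualAltQCharlierPoly_mul hq0 hq1 ha n 0
      refine h.congr ((ae_sum_dirac_iff (dualWeight_pos hq0 hq1 ha) rfl).2 fun m => ?_)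
      simp only [eval_dualAltQCharlierPoly hq0, dualAltQCharlier_zero hq0, mul_one]
    | zero => simp
    | add x y _ _ hx hy =>
      simp only [eval_add]
      exact hx.add hy
    | smul c x _ hx => simpa using hx.const_mul c
  simpa using key (X ^ k)

/-- The elements of `L²(μ)` represented by complex polynomials. -/
def polynomialSubmodule (μ : Measure ℝ) : Submodule ℂ (Lp ℂ 2 μ) where
  carrier := {f | ∃ p : ℂ[X], f =ᵐ[μ] fun x : ℝ => p.eval (x : ℂ)}
  zero_mem' := ⟨0, by simp only [eval_zero]; exact Lp.coeFn_zero ℂ 2 μ⟩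
  add_mem' := by
    rintro f g ⟨p, hp⟩ ⟨r, hr⟩
    refine ⟨p + r, (Lp.coeFn_add f g).trans ?_⟩
    filter_upwards [hp, hr] with x h1 h2
    simp [h1, h2]
  smul_mem' := by
    rintro c f ⟨p, hp⟩
    refine ⟨C c * p, (Lp.coeFn_smul c f).trans ?_⟩
    filter_upwards [hp] with x h1
    simp [h1]

/-- The polynomial classes form a subspace containing every `d_n`, and column completeness makes any
such subspace dense. -/
theorem isExtremalMeasure_dualPointMeasure (hq0 : 0 < q) (hq1 : q < 1) (ha : 0 < a) :
    IsExtremalMeasure (dualPointMeasure a q) := by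
  have hw := dualWeight_pos hq0 hq1 ha
  refine ⟨integrable_pow_dualPointMeasure hq0 hq1 ha, ?_⟩
  change Dense (polynomialSubmodule (dualPointMeasure a q) : Set (Lp ℂ 2 (dualPointMeasure a q)))
  rw [Submodule.dense_iff_topologicalClosure_eq_top]
  refine topologicalClosure_eq_top_of_dualAltQCharlier hq0 hq1 ha rfl _ fun n => ?_
  have hmem : MemLp (fun x : ℝ => (((dualAltQCharlierPoly a q n).eval x : ℝ) : ℂ)) 2
      (dualPointMeasure a q) := by
    refine memLp_two_sum_dirac hw rfl ?_
    simpa only [eval_dualAltQCharlierPoly hq0] using summable_dualWeight_mul_sq hq0 hq1 ha n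
  refine ⟨hmem.toLp _, ⟨(dualAltQCharlierPoly a q n).map (algebraMap ℝ ℂ), ?_⟩, fun m => ?_⟩
  · refine hmem.coeFn_toLp.trans (Eventually.of_forall fun x => ?_)
    beta_reduce
    rw [eval_map, ← Complex.coe_algebraMap, eval₂_at_apply]
  · rw [← eval_dualAltQCharlierPoly hq0]
    exact (ae_sum_dirac_iff hw rfl (P := fun x : ℝ =>
      hmem.toLp _ x = (((dualAltQCharlierPoly a q n).eval x : ℝ) : ℂ))).1 hmem.coeFn_toLp m

end Main

theorem mainTheorem3 (a q : ℝ) (hq0 : 0 < q) (hq1 : q < 1) (ha : 0 < a) :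
    (∃ D : ℕ → DualL2 a q,
      (∀ n m : ℕ, D n m = (dualAltQCharlier a q n m : ℂ)) ∧
      (∀ n k : ℕ, inner ℂ (D n) (D k) =
        if n = k then ((qPoch q q n / (a ^ n * q ^ (n * (n + 1) / 2)) : ℝ) : ℂ) else 0) ∧
      IsOrthogonalBasis D) ∧
    (∃ P : ℕ → ℝ[X],
      (∀ n m : ℕ, (P n).eval (qLattice a q m) = dualAltQCharlier a q n m) ∧
      IsOrthogonalityMeasure (dualPointMeasure a q) P) ∧
    IsExtremalMeasure (dualPointMeasure a q) := by
  refine ⟨exists_dualL2_orthogonalBasis hq0 hq1 ha, ⟨dualAltQCharlierPoly a q,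
    eval_dualAltQCharlierPoly hq0, degree_dualAltQCharlierPoly hq0 hq1 ha,
    integrable_pow_dualPointMeasure hq0 hq1 ha, fun n k hnk => ?_, fun n => ?_⟩,
    isExtremalMeasure_dualPointMeasure hq0 hq1 ha⟩
  · rw [integral_dualAltQCharlierPoly_mul hq0 hq1 ha, if_neg hnk]
  · simp_rw [sq]
    rw [integral_dualAltQCharlierPoly_mul hq0 hq1 ha, if_pos rfl]
    exact inv_pos.2 (charlierWeight_pos hq0 hq1 ha n)
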